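/- For $\delta,\omega>0$ let $$\Theta_\omega(t)=\delta\,\mathrm{cn}\Big[t\sqrt{\tfrac{1+\delta^2}{\omega}},\ \tfrac{\delta}{\sqrt{2(1+\delta^2)}}\Big],$$ where $\mathrm{cn}[u,k]$ is the Jacobi elliptic cosine with modulus $k$; equivalently, $\Theta_\omega$ is the solution of $\ddot\Theta+\frac1\omega\Theta+\frac1\omega\Theta^3=0$ with $\Theta(0)=\delta$, $\dot\Theta(0)=0$. Consider the Hill equation $$\ddot\xi(t)+\big(\omega+\Theta_\omega(t)^2\big)\xi(t)=0. \qquad (*)$$ Its trivial solution is called stable if all solutions of $(*)$ are bounded on $\mathbb R$, and unstable otherwise. Let $\mathcal I$ be the interior of the set of all $(\delta,\omega)\in(0,\infty)^2$ for which the trivial solution of $(*)$ is unstable. For $\ell\in\mathbb N$ the resonance tongue $U_\ell$ of $(*)$ emanating from $(0,\ell)$ is the connected component of $\mathcal I$ whose closure contains the point $(\delta,\omega)=(0,\ell)$ (formally, the union of all such components). Let $\ell\ge2$ be an integer. If $(\delta,\omega)\in U_\ell$, then $$\ell+\Big(\frac{3\ell}{8}-\frac14-\frac1{2\pi\ell}\Big)\delta^2+O(\delta^4)\le\omega\le\ell+\Big(\frac{3\ell}{8}-\frac14+\frac1{2\pi\ell}\Big)\delta^2+O(\delta^4)\qquad\text{as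 }\delta\to0.$$ That is, there are constants $C$ and $\delta_0>0$, depending only on $\ell$, such that for all $(\delta,\omega)\in U_\ell$ with $\delta<\delta_0$ $$\ell+\Big(\frac{3\ell}{8}-\frac14-\frac1{2\pi\ell}\Big)\delta^2-C\delta^4\le\omega\le\ell+\Big(\frac{3\ell}{8}-\frac14+\frac1{2\pi\ell}\Big)\delta^2+C\delta^4.$$ -/

import Mathlib

noncomputable section

namespace DuffingHill

/-- The incomplete elliptic integral of the first kind `F(φ, k)`, with modulus `k`. -/
def ellipticF (k φ : ℝ) : ℝ :=
  ∫ θ in (0 : ℝ)..φ, 1 / Real.sqrt (1 - k ^ 2 * Real.sin θ ^ 2)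

/-- For a modulus `k` with `k ^ 2 < 1`, the map `φ ↦ F(φ, k)` is a bijection of the real line, so
that its inverse function is meaningful. -/
theorem ellipticF_bijective {k : ℝ} (hk : k ^ 2 < 1) : Function.Bijective (ellipticF k) := by
  have hpos : ∀ θ : ℝ, 0 < 1 - k ^ 2 * Real.sin θ ^ 2 := fun θ => by
    nlinarith [Real.sin_sq_le_one θ, sq_nonneg k, sq_nonneg (Real.sin θ)]
  have hcont : Continuous fun θ : ℝ => 1 / Real.sqrt (1 - k ^ 2 * Real.sin θ ^ 2) :=
    continuous_const.div (by fun_prop) fun θ => (Real.sqrt_pos.2 (hpos θ)).ne'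
  have hge : ∀ θ : ℝ, 1 ≤ 1 / Real.sqrt (1 - k ^ 2 * Real.sin θ ^ 2) := fun θ => by
    rw [le_div_iff₀ (Real.sqrt_pos.2 (hpos θ)), one_mul, Real.sqrt_le_iff]
    refine ⟨zero_le_one, ?_⟩
    nlinarith [mul_nonneg (sq_nonneg k) (sq_nonneg (Real.sin θ))]
  have hint : ∀ a b : ℝ, IntervalIntegrable
      (fun θ : ℝ => 1 / Real.sqrt (1 - k ^ 2 * Real.sin θ ^ 2)) MeasureTheory.volume a b :=
    fun a b => hcont.intervalIntegrable a b
  have hgrow : ∀ a b : ℝ, a ≤ b → b - a ≤ ellipticF k b - ellipticF k a := fun a b hab => by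
    have h1 : ellipticF k b - ellipticF k a
        = ∫ θ in a..b, 1 / Real.sqrt (1 - k ^ 2 * Real.sin θ ^ 2) :=
      intervalIntegral.integral_interval_sub_left (hint 0 b) (hint 0 a)
    have h2 := intervalIntegral.integral_mono_on hab
      (continuous_const.intervalIntegrable (μ := MeasureTheory.volume) a b) (hint a b)
      fun θ _ => hge θ
    rw [intervalIntegral.integral_const, smul_eq_mul, mul_one] at h2
    rw [h1]; exact h2
  have hF0 : ellipticF k 0 = 0 := intervalIntegral.integral_same
  have hFc : Continuous (ellipticF k) := intervalIntegral.continuous_primitive hint 0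
  refine ⟨StrictMono.injective fun a b hab => by linarith [hgrow a b hab.le], ?_⟩
  refine hFc.surjective ?_ ?_
  · refine Filter.tendsto_atTop_mono' _ ?_ Filter.tendsto_id
    filter_upwards [Filter.eventually_ge_atTop (0 : ℝ)] with x hx
    simpa [hF0] using hgrow 0 x hx
  · refine Filter.tendsto_atBot_mono' _ ?_ Filter.tendsto_id
    filter_upwards [Filter.eventually_le_atBot (0 : ℝ)] with x hx
    simpa [hF0] using hgrow x 0 hx

/-- The Jacobi amplitude `am(u, k)`: the number `φ` with `F(φ, k) = u`. It is used only for moduli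
with `k ^ 2 < 1`. -/
def jacobiAm (u k : ℝ) : ℝ :=
  Function.invFun (ellipticF k) u

/-- The Jacobi elliptic cosine `cn[u, k] = cos (am(u, k))`, with modulus `k`. -/
def jacobiCn (u k : ℝ) : ℝ :=
  Real.cos (jacobiAm u k)

/-- `Θ_ω(t) = δ cn[t √((1 + δ²)/ω), δ / √(2 (1 + δ²))]`, the solution of
`Θ'' + Θ/ω + Θ³/ω = 0`, `Θ(0) = δ`, `Θ'(0) = 0`. The modulus has square less than `1/2`. -/
def duffingSol (δ ω t : ℝ) : ℝ :=
  δ * jacobiCn (t * Real.sqrt ((1 + δ ^ 2) / ω)) (δ / Real.sqrt (2 * (1 + δ ^ 2)))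

/-- `ξ` solves the Hill equation `ξ'' + p ξ = 0` on the whole line. -/
def IsHillSolution (p ξ : ℝ → ℝ) : Prop :=
  ∃ η : ℝ → ℝ, (∀ t, HasDerivAt ξ (η t) t) ∧ ∀ t, HasDerivAt η (-(p t * ξ t)) t

/-- The trivial solution of `ξ'' + p ξ = 0` is stable: all solutions are bounded on the line. -/
def HillStable (p : ℝ → ℝ) : Prop :=
  ∀ ξ : ℝ → ℝ, IsHillSolution p ξ → ∃ M : ℝ, ∀ t, |ξ t| ≤ M

/-- The coefficient `ω + Θ_ω(t)²` of the scaled Hill equation. -/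
def scaledCoeff (δ ω t : ℝ) : ℝ :=
  ω + duffingSol δ ω t ^ 2

/-- The parameters `(δ, ω)` in the open quarter plane for which the trivial solution of the scaled
Hill equation is unstable. -/
def unstableSet : Set (ℝ × ℝ) :=
  {x | 0 < x.1 ∧ 0 < x.2 ∧ ¬ HillStable (scaledCoeff x.1 x.2)}

/-- The resonance tongue `U_ℓ` emanating from `(0, ℓ)`: the instability regions are the connected
components of the interior of the set of unstable parameters (the resonance lines, which bound
them, are not part of them), and `U_ℓ` is the one whose closure contains `(0, ℓ)`. -/
def tongue (l : ℕ) : Set (ℝ × ℝ) :=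
  {x | x ∈ interior unstableSet ∧
    ((0 : ℝ), (l : ℝ)) ∈ closure (connectedComponentIn (interior unstableSet) x)}

end DuffingHill

end

/-!
Take the Jacobi amplitude `φ` as independent variable. Then `Θ_ω = δ cos φ`, so the Hill equation
becomes an explicit first-order system with `π`-periodic coefficients (`IsAmpSolution`), and the
angle `θ` of a solution in the phase plane satisfies the Prüfer equation
`θ' = (ω + δ² cos² φ sin² θ) / √(1 + δ² - (δ² / 2) sin² φ)` (`IsPhase`).

If the Hill equation is unstable, its monodromy has a real eigenvector, and the angle that starts
there advances by an integer multiple `n π` along a period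
(`exists_hasRotation_of_mem_unstableSet`). The displacements of two angles at the same parameters
differ by less than `π`, with a margin that is uniform in the initial values
(`IsPhase.abs_displacement_sub_le`), so `n` is unique and, by Grönwall's inequality, locally constant
in `(δ, ω)` on the unstable set. Hence it is constant on every component of its interior
(`HasRotation.of_isPreconnected`), and near `(0, l)` it equals `l`: it is `l` on the whole tongue.

Finally, `θ π - θ 0 = l π` forces `θ φ = θ 0 + l φ + O(δ²)`; inserting this into the right-hand side
and integrating over a period, the oscillating part of `cos² φ sin² (θ 0 + l φ)` drops out for
`l ≥ 2`, and `l = ω (1 - 3 δ² / 8) + δ² / 4 + O(δ⁴)` remains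
(`HasRotation.abs_sub_le_of_two_le`). The tongue is thus even of width `O(δ⁴)`, and the
terms `± δ² / (2 π l)` of the theorem leave room to spare.
-/

namespace DuffingHill

open Set Filter Topology

/-! ### The phase equation -/

/-- The derivative of the rescaled Jacobi amplitude `φ` with respect to the time `s = t / √ω`. -/
noncomputable def speed (δ φ : ℝ) : ℝ :=
  Real.sqrt (1 + δ ^ 2 - δ ^ 2 / 2 * Real.sin φ ^ 2)

/-- The slope field of the Prüfer angle `θ` of the Hill equation, in the amplitude variable `φ`. The
angle is measured so that `(ξ, ξ' / √ω)` is a multiple of `(sin θ, cos θ)`. -/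
noncomputable def phaseField (δ ω φ θ : ℝ) : ℝ :=
  (ω + δ ^ 2 * Real.cos φ ^ 2 * Real.sin θ ^ 2) / speed δ φ

/-- `θ` is a Prüfer angle along one period `[0, π]` of the coefficient. -/
def IsPhase (δ ω : ℝ) (θ : ℝ → ℝ) : Prop :=
  ∀ φ ∈ Icc 0 Real.pi, HasDerivWithinAt θ (phaseField δ ω φ (θ φ)) (Icc 0 Real.pi) φ

theorem one_le_radicand (δ φ : ℝ) : 1 ≤ 1 + δ ^ 2 - δ ^ 2 / 2 * Real.sin φ ^ 2 := by
  nlinarith [Real.sin_sq_le_one φ, sq_nonneg δ]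

theorem one_le_speed (δ φ : ℝ) : 1 ≤ speed δ φ :=
  Real.one_le_sqrt.2 (one_le_radicand δ φ)

theorem speed_pos (δ φ : ℝ) : 0 < speed δ φ :=
  zero_lt_one.trans_le (one_le_speed δ φ)

theorem sq_speed (δ φ : ℝ) : speed δ φ ^ 2 = 1 + δ ^ 2 - δ ^ 2 / 2 * Real.sin φ ^ 2 :=
  Real.sq_sqrt (zero_le_one.trans (one_le_radicand δ φ))

theorem continuous_speed (δ : ℝ) : Continuous (speed δ) := by
  unfold speed; fun_prop

theorem abs_one_div_speed_sub_le (δ δ' φ : ℝ) :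
    |1 / speed δ φ - 1 / speed δ' φ| ≤ |δ ^ 2 - δ' ^ 2| := by
  have h1 := one_le_speed δ φ
  have h2 := one_le_speed δ' φ
  have e : 1 / speed δ φ - 1 / speed δ' φ = (δ' ^ 2 - δ ^ 2) * (1 - Real.sin φ ^ 2 / 2) /
      (speed δ φ * speed δ' φ * (speed δ φ + speed δ' φ)) := by
    have := sq_speed δ φ
    have := sq_speed δ' φ
    have : (δ' ^ 2 - δ ^ 2) * (1 - Real.sin φ ^ 2 / 2) =
        (speed δ' φ - speed δ φ) * (speed δ φ + speed δ' φ) := by linarith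
    rw [this]
    field_simp
  have hd : 1 ≤ speed δ φ * speed δ' φ * (speed δ φ + speed δ' φ) :=
    one_le_mul_of_one_le_of_one_le (one_le_mul_of_one_le_of_one_le h1 h2) (by linarith)
  rw [e, abs_div, abs_mul, abs_of_pos (zero_lt_one.trans_le hd), abs_sub_comm]
  have hs : |1 - Real.sin φ ^ 2 / 2| ≤ 1 := by
    rw [abs_le]; constructor <;> nlinarith [Real.sin_sq_le_one φ, sq_nonneg (Real.sin φ)]
  rw [div_le_iff₀ (zero_lt_one.trans_le hd)]
  calc _ ≤ |δ ^ 2 - δ' ^ 2| * 1 := by gcongr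
    _ ≤ _ := by gcongr

theorem trig_weight_bounds (φ θ : ℝ) :
    0 ≤ Real.cos φ ^ 2 * Real.sin θ ^ 2 ∧ Real.cos φ ^ 2 * Real.sin θ ^ 2 ≤ 1 :=
  ⟨by positivity, mul_le_one₀ (Real.cos_sq_le_one φ) (by positivity) (Real.sin_sq_le_one θ)⟩

theorem abs_phaseField_sub_params_le (δ ω δ' φ θ : ℝ) {ω' : ℝ} (hω' : 0 ≤ ω') :
    |phaseField δ ω φ θ - phaseField δ' ω' φ θ| ≤
      |ω - ω'| + (1 + ω' + δ' ^ 2) * |δ ^ 2 - δ' ^ 2| := by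
  obtain ⟨hX0, hX1⟩ := trig_weight_bounds φ θ
  set X := Real.cos φ ^ 2 * Real.sin θ ^ 2
  have h1 := one_le_speed δ φ
  have e : phaseField δ ω φ θ - phaseField δ' ω' φ θ =
      (ω - ω' + (δ ^ 2 - δ' ^ 2) * X) / speed δ φ +
        (ω' + δ' ^ 2 * X) * (1 / speed δ φ - 1 / speed δ' φ) := by
    simp only [phaseField, mul_assoc]; ring
  have b1 : |(ω - ω' + (δ ^ 2 - δ' ^ 2) * X) / speed δ φ| ≤ |ω - ω'| + |δ ^ 2 - δ' ^ 2| := by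
    rw [abs_div, abs_of_pos (speed_pos δ φ)]
    refine (div_le_self (abs_nonneg _) h1).trans ((abs_add_le _ _).trans ?_)
    rw [abs_mul, abs_of_nonneg hX0]
    gcongr
    exact mul_le_of_le_one_right (abs_nonneg _) hX1
  have b2 : |(ω' + δ' ^ 2 * X) * (1 / speed δ φ - 1 / speed δ' φ)| ≤
      (ω' + δ' ^ 2) * |δ ^ 2 - δ' ^ 2| := by
    rw [abs_mul, abs_of_nonneg (by positivity)]
    refine mul_le_mul ?_ (abs_one_div_speed_sub_le δ δ' φ) (abs_nonneg _) (by positivity)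
    gcongr
    exact mul_le_of_le_one_right (sq_nonneg _) hX1
  rw [e]
  refine (abs_add_le _ _).trans ((add_le_add b1 b2).trans (le_of_eq ?_))
  ring

theorem abs_sin_sq_sub_sin_sq_le (x y : ℝ) : |Real.sin x ^ 2 - Real.sin y ^ 2| ≤ |x - y| := by
  have e : Real.sin x ^ 2 - Real.sin y ^ 2 = Real.sin (x + y) * Real.sin (x - y) := by
    rw [Real.sin_add, Real.sin_sub]
    have h1 := Real.sin_sq_add_cos_sq x
    have h2 := Real.sin_sq_add_cos_sq y
    linear_combination Real.sin y ^ 2 * h1 - Real.sin x ^ 2 * h2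
  rw [e, abs_mul]
  exact (mul_le_mul (Real.abs_sin_le_one _) Real.abs_sin_le_abs (abs_nonneg _)
    zero_le_one).trans_eq (one_mul _)

theorem abs_phaseField_sub_le (δ ω φ x y : ℝ) :
    |phaseField δ ω φ x - phaseField δ ω φ y| ≤ δ ^ 2 * |x - y| := by
  have e : phaseField δ ω φ x - phaseField δ ω φ y =
      δ ^ 2 * (Real.cos φ ^ 2 * (Real.sin x ^ 2 - Real.sin y ^ 2)) / speed δ φ := by
    simp only [phaseField]; ring
  rw [e, abs_div, abs_of_pos (speed_pos δ φ)]
  refine (div_le_self (abs_nonneg _) (one_le_speed δ φ)).trans ?_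
  rw [abs_mul, abs_mul, abs_of_nonneg (sq_nonneg δ), abs_of_nonneg (sq_nonneg (Real.cos φ))]
  refine mul_le_mul_of_nonneg_left ?_ (sq_nonneg δ)
  exact (mul_le_mul (Real.cos_sq_le_one _) (abs_sin_sq_sub_sin_sq_le x y) (abs_nonneg _)
    zero_le_one).trans_eq (one_mul _)

theorem lipschitzWith_phaseField (δ ω φ : ℝ) :
    LipschitzWith ⟨δ ^ 2, sq_nonneg δ⟩ (phaseField δ ω φ) :=
  LipschitzWith.of_dist_le_mul fun x y => abs_phaseField_sub_le δ ω φ x y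

theorem phaseField_add_int_mul_pi (δ ω φ θ : ℝ) (n : ℤ) :
    phaseField δ ω φ (θ + n * Real.pi) = phaseField δ ω φ θ := by
  have : Real.sin (θ + n * Real.pi) ^ 2 = Real.sin θ ^ 2 := by
    rw [Real.sin_add_int_mul_pi, mul_pow, ← zpow_natCast, ← zpow_mul, mul_comm n, zpow_mul]
    norm_num
  simp only [phaseField, this]

theorem phaseField_mem_Icc {ω : ℝ} (hω : 0 ≤ ω) (δ φ θ : ℝ) :
    phaseField δ ω φ θ ∈ Icc 0 (ω + δ ^ 2) := by
  obtain ⟨hX0, hX1⟩ := trig_weight_bounds φ θ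
  rw [phaseField, mul_assoc]
  refine ⟨by have := speed_pos δ φ; positivity, ?_⟩
  refine (div_le_self (by positivity) (one_le_speed δ φ)).trans ?_
  gcongr
  exact mul_le_of_le_one_right (sq_nonneg _) hX1

theorem exists_isPhase {ω : ℝ} (hω : 0 ≤ ω) (δ θ₀ : ℝ) : ∃ θ, IsPhase δ ω θ ∧ θ 0 = θ₀ := by
  have hL : (0 : ℝ) ≤ ω + δ ^ 2 := by positivity
  have hP : IsPicardLindelof (phaseField δ ω) (⟨0, by simp [Real.pi_pos.le]⟩ : Icc 0 Real.pi) θ₀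
      ⟨(ω + δ ^ 2) * Real.pi, mul_nonneg hL Real.pi_pos.le⟩ 0 ⟨ω + δ ^ 2, hL⟩
      ⟨δ ^ 2, sq_nonneg δ⟩ :=
    { lipschitzOnWith := fun t _ => (lipschitzWith_phaseField δ ω t).lipschitzOnWith
      continuousOn := fun x _ => by
        refine Continuous.continuousOn (Continuous.div (by fun_prop) (continuous_speed δ) ?_)
        exact fun φ => (speed_pos δ φ).ne'
      norm_le := fun t _ x _ => by
        have h := phaseField_mem_Icc hω δ t x
        rw [Real.norm_eq_abs, abs_of_nonneg h.1]
        exact h.2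
      mul_max_le := by
        simp only [NNReal.coe_zero, sub_zero, sub_self, max_eq_left Real.pi_pos.le]
        exact le_rfl }
  obtain ⟨α, h0, h1⟩ := hP.exists_eq_forall_mem_Icc_hasDerivWithinAt₀
  exact ⟨α, h1, h0⟩

theorem IsPhase.continuousOn {δ ω : ℝ} {θ : ℝ → ℝ} (h : IsPhase δ ω θ) :
    ContinuousOn θ (Icc 0 Real.pi) := fun φ hφ => (h φ hφ).continuousWithinAt

theorem IsPhase.hasDerivWithinAt_Ici {δ ω : ℝ} {θ : ℝ → ℝ} (h : IsPhase δ ω θ) {φ : ℝ}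
    (hφ : φ ∈ Ico 0 Real.pi) : HasDerivWithinAt θ (phaseField δ ω φ (θ φ)) (Ici φ) φ :=
  (h φ (Ico_subset_Icc_self hφ)).mono_of_mem_nhdsWithin (Icc_mem_nhdsGE_of_mem hφ)

theorem IsPhase.add_int_mul_pi {δ ω : ℝ} {θ : ℝ → ℝ} (h : IsPhase δ ω θ) (n : ℤ) :
    IsPhase δ ω fun φ => θ φ + n * Real.pi := fun φ hφ => by
  rw [phaseField_add_int_mul_pi]
  exact (h φ hφ).add_const _

/-! ### The rotation number is locally constant -/

/-- The factor by which the distance of two phases shrinks at most along a period. -/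
noncomputable def contraction (δ : ℝ) : ℝ := Real.exp (-(δ ^ 2 + 1) * Real.pi)

theorem contraction_pos (δ : ℝ) : 0 < contraction δ := Real.exp_pos _

theorem contraction_le_one (δ : ℝ) : contraction δ ≤ 1 :=
  Real.exp_le_one_iff.2 (by nlinarith [Real.pi_pos, sq_nonneg δ])

/-- Ordered phases stay ordered, with a quantitative gap. -/
theorem IsPhase.gap {δ ω : ℝ} {α β : ℝ → ℝ} (hα : IsPhase δ ω α) (hβ : IsPhase δ ω β)
    (h0 : α 0 < β 0) : (β 0 - α 0) * contraction δ ≤ β Real.pi - α Real.pi := by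
  have hB : ∀ x : ℝ, HasDerivAt (fun φ => -((β 0 - α 0) * Real.exp (-(δ ^ 2 + 1) * φ)))
      ((δ ^ 2 + 1) * ((β 0 - α 0) * Real.exp (-(δ ^ 2 + 1) * x))) x := fun x => by
    have h := ((((hasDerivAt_id x).const_mul (-(δ ^ 2 + 1))).exp).const_mul (β 0 - α 0)).neg
    refine h.congr_deriv ?_
    simp only [id]
    ring
  have key := image_le_of_deriv_right_lt_deriv_boundary'
    (f := fun φ => α φ - β φ)
    (f' := fun φ => phaseField δ ω φ (α φ) - phaseField δ ω φ (β φ))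
    (a := 0) (b := Real.pi) (hα.continuousOn.sub hβ.continuousOn)
    (fun x hx => (hα.hasDerivWithinAt_Ici hx).sub (hβ.hasDerivWithinAt_Ici hx))
    (B := fun φ => -((β 0 - α 0) * Real.exp (-(δ ^ 2 + 1) * φ)))
    (B' := fun φ => (δ ^ 2 + 1) * ((β 0 - α 0) * Real.exp (-(δ ^ 2 + 1) * φ)))
    (by simp) (fun x _ => (hB x).continuousAt.continuousWithinAt)
    (fun x _ => (hB x).hasDerivWithinAt) ?_ (right_mem_Icc.2 Real.pi_pos.le)
  · simp only [contraction]
    linarith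
  · intro x _ hx
    have hpos : 0 < (β 0 - α 0) * Real.exp (-(δ ^ 2 + 1) * x) :=
      mul_pos (sub_pos.2 h0) (Real.exp_pos _)
    have h1 := (le_abs_self _).trans (abs_phaseField_sub_le δ ω x (α x) (β x))
    rw [hx, abs_neg, abs_of_pos hpos] at h1
    linarith

/-- The displacements over a period of two phases differ by less than `π`, uniformly. -/
theorem IsPhase.abs_displacement_sub_le {δ ω : ℝ} {α β : ℝ → ℝ} (hα : IsPhase δ ω α)
    (hβ : IsPhase δ ω β) :
    |(β Real.pi - β 0) - (α Real.pi - α 0)| ≤ Real.pi * (1 - contraction δ) := by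
  have hpi := Real.pi_pos
  have hκ := contraction_pos δ
  have hκ1 := contraction_le_one δ
  -- Displacements are unchanged by multiples of `π`, so that `α 0 ≤ β 0 < α 0 + π` may be assumed.
  wlog hr : α 0 ≤ β 0 ∧ β 0 < α 0 + Real.pi generalizing α
  · have h1 := Int.floor_le ((β 0 - α 0) / Real.pi)
    have h2 := Int.lt_floor_add_one ((β 0 - α 0) / Real.pi)
    rw [le_div_iff₀ hpi] at h1
    rw [div_lt_iff₀ hpi] at h2
    have := this (hα.add_int_mul_pi ⌊(β 0 - α 0) / Real.pi⌋) ⟨by linarith, by linarith⟩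
    simpa using this
  obtain ⟨hr1, hr2⟩ := hr
  have up := hβ.gap (hα.add_int_mul_pi 1) (by simpa using hr2)
  simp only [Int.cast_one, one_mul] at up
  rw [abs_le]
  refine ⟨?_, by nlinarith⟩
  rcases hr1.eq_or_lt with h | h
  · have lo := (hα.add_int_mul_pi (-1)).gap hβ (by simp; linarith)
    simp only [Int.cast_neg, Int.cast_one, neg_mul, one_mul] at lo
    nlinarith
  · have lo := hα.gap hβ h
    nlinarith

theorem IsPhase.abs_sub_le_gronwallBound {δ ω δ' ω' : ℝ} (hω' : 0 ≤ ω') {α β : ℝ → ℝ}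
    (hα : IsPhase δ ω α) (hβ : IsPhase δ' ω' β) (h0 : α 0 = β 0) :
    |α Real.pi - β Real.pi| ≤
      gronwallBound 0 (δ' ^ 2) (|ω - ω'| + (1 + ω' + δ' ^ 2) * |δ ^ 2 - δ' ^ 2|) Real.pi := by
  have h := dist_le_of_approx_trajectories_ODE (v := phaseField δ' ω') (δ := 0) (εg := 0)
    (fun t => lipschitzWith_phaseField δ' ω' t) hα.continuousOn
    (fun t ht => hα.hasDerivWithinAt_Ici ht)
    (fun t _ => abs_phaseField_sub_params_le δ ω δ' t (α t) hω')
    hβ.continuousOn (fun t ht => hβ.hasDerivWithinAt_Ici ht) (fun t _ => by simp)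
    (by simp [h0]) Real.pi (right_mem_Icc.2 Real.pi_pos.le)
  simpa only [Real.dist_eq, add_zero, sub_zero] using! h

/-- The parameters `x = (δ, ω)` have rotation number `n`: some phase advances by exactly `n π` along
a period. -/
def HasRotation (x : ℝ × ℝ) (n : ℤ) : Prop :=
  ∃ θ, IsPhase x.1 x.2 θ ∧ θ Real.pi - θ 0 = n * Real.pi

theorem HasRotation.eventually_eq {x₀ : ℝ × ℝ} {n₀ : ℤ} (hω : 0 ≤ x₀.2) (h₀ : HasRotation x₀ n₀) :
    ∀ᶠ x in 𝓝 x₀, ∀ n, HasRotation x n → n = n₀ := by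
  have hpi := Real.pi_pos
  have hcont : Continuous fun x : ℝ × ℝ => gronwallBound 0 (x₀.1 ^ 2)
      (|x.2 - x₀.2| + (1 + x₀.2 + x₀.1 ^ 2) * |x.1 ^ 2 - x₀.1 ^ 2|) Real.pi :=
    (gronwallBound_continuous_ε _ _ _).comp (by fun_prop)
  have hlim := hcont.tendsto x₀
  simp only [sub_self, abs_zero, mul_zero, add_zero, gronwallBound_ε0_δ0] at hlim
  filter_upwards [hlim.eventually_lt_const (mul_pos hpi (contraction_pos x₀.1))] with x hx n hn
  obtain ⟨α, hα, hαn⟩ := hn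
  obtain ⟨β, hβ, hβn⟩ := h₀
  obtain ⟨γ, hγ, hγ0⟩ := exists_isPhase hω x₀.1 (α 0)
  have h1 := hα.abs_sub_le_gronwallBound hω hγ hγ0.symm
  have h2 := hβ.abs_displacement_sub_le hγ
  have h3 : |((n - n₀ : ℤ) : ℝ)| * Real.pi < 1 * Real.pi := by
    rw [← abs_of_pos hpi, ← abs_mul, abs_of_pos hpi]
    have e : ((n - n₀ : ℤ) : ℝ) * Real.pi =
        (α Real.pi - γ Real.pi) + ((γ Real.pi - γ 0) - (β Real.pi - β 0)) := by
      push_cast; rw [hγ0]; linarith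
    rw [e]
    refine (abs_add_le _ _).trans_lt ?_
    linarith
  have h4 := lt_of_mul_lt_mul_right h3 hpi.le
  rw [← Int.cast_abs] at h4
  have h5 : |n - n₀| < 1 := by exact_mod_cast h4
  exact sub_eq_zero.1 (Int.abs_lt_one_iff.1 h5)

/-- On a preconnected set all of whose points have a rotation number, it is constant. -/
theorem HasRotation.of_isPreconnected {S : Set (ℝ × ℝ)} (hS : IsPreconnected S)
    (hpos : ∀ x ∈ S, 0 ≤ x.2) (hrot : ∀ x ∈ S, ∃ n, HasRotation x n) {x y : ℝ × ℝ} (hx : x ∈ S)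
    (hy : y ∈ S) {n : ℤ} (hn : HasRotation x n) : HasRotation y n := by
  classical
  choose! N hN using hrot
  have hc : ContinuousOn N S := fun z hz => by
    refine tendsto_nhds_of_eventually_eq ?_
    filter_upwards [nhdsWithin_le_nhds ((hN z hz).eventually_eq (hpos z hz)),
      self_mem_nhdsWithin] with w hw hwS
    exact hw _ (hN w hwS)
  have h1 : n = N x := ((hN x hx).eventually_eq (hpos x hx)).self_of_nhds n hn
  rw [h1, hS.constant hc hx hy]
  exact hN y hy

/-! ### The Hill equation in the amplitude variable -/

/-- `(u, v)` solves the Hill equation, rewritten as a first-order system whose independent variable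
is the Jacobi amplitude: `u` is `ξ` and `v` is `ξ' / √ω`. The coefficients have period `π`. -/
def IsAmpSolution (δ ω : ℝ) (u v : ℝ → ℝ) : Prop :=
  (∀ φ, HasDerivAt u (ω / speed δ φ * v φ) φ) ∧
    ∀ φ, HasDerivAt v (-((ω + δ ^ 2 * Real.cos φ ^ 2) / speed δ φ * u φ)) φ

/-- The time `t` at which the Jacobi amplitude in `Θ_ω` takes the value `φ`. -/
noncomputable def timeOfAmplitude (δ ω φ : ℝ) : ℝ :=
  Real.sqrt (ω / (1 + δ ^ 2)) * ellipticF (δ / Real.sqrt (2 * (1 + δ ^ 2))) φ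

theorem sq_modulus (δ : ℝ) :
    (δ / Real.sqrt (2 * (1 + δ ^ 2))) ^ 2 = δ ^ 2 / (2 * (1 + δ ^ 2)) := by
  rw [div_pow, Real.sq_sqrt (by positivity)]

theorem sq_modulus_lt_one (δ : ℝ) : (δ / Real.sqrt (2 * (1 + δ ^ 2))) ^ 2 < 1 := by
  rw [sq_modulus, div_lt_one (by positivity)]
  nlinarith [sq_nonneg δ]

theorem hasDerivAt_ellipticF {k : ℝ} (hk : k ^ 2 < 1) (φ : ℝ) :
    HasDerivAt (ellipticF k) (1 / Real.sqrt (1 - k ^ 2 * Real.sin φ ^ 2)) φ := by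
  have hpos : ∀ θ : ℝ, 0 < 1 - k ^ 2 * Real.sin θ ^ 2 := fun θ => by
    nlinarith [Real.sin_sq_le_one θ, sq_nonneg k, sq_nonneg (Real.sin θ)]
  have hcont : Continuous fun θ : ℝ => 1 / Real.sqrt (1 - k ^ 2 * Real.sin θ ^ 2) :=
    continuous_const.div (by fun_prop) fun θ => (Real.sqrt_pos.2 (hpos θ)).ne'
  exact intervalIntegral.integral_hasDerivAt_right (hcont.intervalIntegrable _ _)
    (hcont.stronglyMeasurableAtFilter _ _) hcont.continuousAt

theorem hasDerivAt_timeOfAmplitude {ω : ℝ} (hω : 0 < ω) (δ φ : ℝ) :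
    HasDerivAt (timeOfAmplitude δ ω) (Real.sqrt ω / speed δ φ) φ := by
  refine ((hasDerivAt_ellipticF (sq_modulus_lt_one δ) φ).const_mul _).congr_deriv ?_
  have h1 : (0 : ℝ) < 1 + δ ^ 2 := by positivity
  have e : speed δ φ = Real.sqrt (1 + δ ^ 2) *
      Real.sqrt (1 - (δ / Real.sqrt (2 * (1 + δ ^ 2))) ^ 2 * Real.sin φ ^ 2) := by
    rw [← Real.sqrt_mul h1.le, speed, sq_modulus]
    congr 1
    field_simp
  rw [e, Real.sqrt_div hω.le]
  field_simp

theorem timeOfAmplitude_surjective {ω : ℝ} (hω : 0 < ω) (δ : ℝ) :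
    Function.Surjective (timeOfAmplitude δ ω) := fun t => by
  have h : 0 < Real.sqrt (ω / (1 + δ ^ 2)) := Real.sqrt_pos.2 (by positivity)
  obtain ⟨φ, hφ⟩ := (ellipticF_bijective (sq_modulus_lt_one δ)).2 (t / Real.sqrt (ω / (1 + δ ^ 2)))
  exact ⟨φ, by rw [timeOfAmplitude, hφ, mul_div_cancel₀ _ h.ne']⟩

theorem duffingSol_timeOfAmplitude {ω : ℝ} (hω : 0 < ω) (δ φ : ℝ) :
    duffingSol δ ω (timeOfAmplitude δ ω φ) = δ * Real.cos φ := by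
  have h : timeOfAmplitude δ ω φ * Real.sqrt ((1 + δ ^ 2) / ω) =
      ellipticF (δ / Real.sqrt (2 * (1 + δ ^ 2))) φ := by
    have h1 : Real.sqrt (ω / (1 + δ ^ 2)) * Real.sqrt ((1 + δ ^ 2) / ω) = 1 := by
      rw [← Real.sqrt_mul (by positivity), Real.sqrt_eq_one]
      field_simp
    rw [timeOfAmplitude, mul_right_comm, h1, one_mul]
  rw [duffingSol, jacobiCn, jacobiAm, h,
    Function.leftInverse_invFun (ellipticF_bijective (sq_modulus_lt_one δ)).1 φ]

theorem IsHillSolution.exists_isAmpSolution {δ ω : ℝ} (hω : 0 < ω) {ξ : ℝ → ℝ}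
    (h : IsHillSolution (scaledCoeff δ ω) ξ) :
    ∃ v, IsAmpSolution δ ω (fun φ => ξ (timeOfAmplitude δ ω φ)) v := by
  obtain ⟨η, hξ, hη⟩ := h
  have hs : 0 < Real.sqrt ω := Real.sqrt_pos.2 hω
  have hss : Real.sqrt ω ^ 2 = ω := Real.sq_sqrt hω.le
  refine ⟨fun φ => η (timeOfAmplitude δ ω φ) / Real.sqrt ω, fun φ => ?_, fun φ => ?_⟩
  · refine ((hξ _).comp φ (hasDerivAt_timeOfAmplitude hω δ φ)).congr_deriv ?_
    have := speed_pos δ φ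
    field_simp
    rw [hss]
  · refine (((hη _).comp φ (hasDerivAt_timeOfAmplitude hω δ φ)).div_const _).congr_deriv ?_
    have := speed_pos δ φ
    rw [scaledCoeff, duffingSol_timeOfAmplitude hω]
    field_simp

namespace IsAmpSolution

variable {δ ω : ℝ} {u v u₁ v₁ u₂ v₂ : ℝ → ℝ}

theorem speed_add_pi (δ φ : ℝ) : speed δ (φ + Real.pi) = speed δ φ := by
  simp [speed, Real.sin_add_pi]

theorem shift (h : IsAmpSolution δ ω u v) :
    IsAmpSolution δ ω (fun φ => u (φ + Real.pi)) fun φ => v (φ + Real.pi) := by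
  refine ⟨fun φ => ?_, fun φ => ?_⟩
  · simpa only [speed_add_pi] using (h.1 (φ + Real.pi)).comp_add_const φ Real.pi
  · simpa only [speed_add_pi, Real.cos_add_pi, neg_sq] using
      (h.2 (φ + Real.pi)).comp_add_const φ Real.pi

theorem sub_const_mul (h₁ : IsAmpSolution δ ω u₁ v₁) (h₂ : IsAmpSolution δ ω u₂ v₂) (μ : ℝ) :
    IsAmpSolution δ ω (fun φ => u₁ φ - μ * u₂ φ) fun φ => v₁ φ - μ * v₂ φ := by
  refine ⟨fun φ => ?_, fun φ => ?_⟩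
  · exact ((h₁.1 φ).sub ((h₂.1 φ).const_mul μ)).congr_deriv (by ring)
  · exact ((h₁.2 φ).sub ((h₂.2 φ).const_mul μ)).congr_deriv (by ring)

theorem wronskian_eq (h₁ : IsAmpSolution δ ω u₁ v₁) (h₂ : IsAmpSolution δ ω u₂ v₂) (x y : ℝ) :
    u₁ x * v₂ x - v₁ x * u₂ x = u₁ y * v₂ y - v₁ y * u₂ y := by
  have hd : ∀ φ, HasDerivAt (fun φ => u₁ φ * v₂ φ - v₁ φ * u₂ φ) 0 φ := fun φ =>
    (((h₁.1 φ).mul (h₂.2 φ)).sub ((h₁.2 φ).mul (h₂.1 φ))).congr_deriv (by ring)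
  exact is_const_of_deriv_eq_zero (fun φ => (hd φ).differentiableAt) (fun φ => (hd φ).deriv) x y

theorem eq_zero_of_apply_eq_zero (h : IsAmpSolution δ ω u v) (hω : 0 ≤ ω) {x : ℝ} (hu : u x = 0)
    (hv : v x = 0) (y : ℝ) : u y = 0 ∧ v y = 0 := by
  have hK : 0 ≤ ω + δ ^ 2 := by positivity
  have hb : ∀ c φ : ℝ, 0 ≤ c → c ≤ ω + δ ^ 2 → |c / speed δ φ| ≤ ω + δ ^ 2 := fun c φ h0 h1 => by
    rw [abs_of_nonneg (div_nonneg h0 (speed_pos δ φ).le)]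
    exact (div_le_self h0 (one_le_speed δ φ)).trans h1
  have key := ODE_solution_unique_univ (t₀ := x)
    (v := fun φ (w : ℝ × ℝ) =>
      (ω / speed δ φ * w.2, -((ω + δ ^ 2 * Real.cos φ ^ 2) / speed δ φ * w.1)))
    (s := fun _ => univ) (K := ⟨ω + δ ^ 2, hK⟩) (f := fun φ => (u φ, v φ)) (g := fun _ => 0)
    (fun t => (LipschitzWith.of_dist_le_mul fun w z => ?_).lipschitzOnWith)
    (fun t => ⟨(h.1 t).prodMk (h.2 t), mem_univ _⟩)
    (fun t => ⟨by simpa using! hasDerivAt_const t (0 : ℝ × ℝ), mem_univ _⟩) (by simp [hu, hv])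
  · have := congrFun key y
    simpa using this
  · rw [Prod.dist_eq, Prod.dist_eq]
    simp only [Real.dist_eq]
    refine max_le ?_ ?_
    · rw [← mul_sub, abs_mul]
      exact mul_le_mul (hb ω t hω (by nlinarith [sq_nonneg δ])) (le_max_right _ _) (abs_nonneg _) hK
    · rw [← neg_sub', ← mul_sub, abs_neg, abs_mul]
      refine mul_le_mul (hb _ t (by positivity) ?_) (le_max_left _ _) (abs_nonneg _) hK
      gcongr
      exact mul_le_of_le_one_right (sq_nonneg _) (Real.cos_sq_le_one _)

/-- A phase that starts in the direction of a solution keeps the direction of this solution. -/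
theorem phase_parallel (h : IsAmpSolution δ ω u v) {θ : ℝ → ℝ} (hθ : IsPhase δ ω θ)
    (h0 : u 0 * Real.cos (θ 0) - v 0 * Real.sin (θ 0) = 0) :
    u Real.pi * Real.cos (θ Real.pi) - v Real.pi * Real.sin (θ Real.pi) = 0 := by
  set k : ℝ → ℝ := fun φ =>
    δ ^ 2 * Real.cos φ ^ 2 / speed δ φ * Real.sin (θ φ) * Real.cos (θ φ) with hk
  -- The component `f` of the solution across the phase direction solves `f' = k f`.
  have hd : ∀ φ ∈ Ico 0 Real.pi,
      HasDerivWithinAt (fun φ => u φ * Real.cos (θ φ) - v φ * Real.sin (θ φ))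
        (k φ * (u φ * Real.cos (θ φ) - v φ * Real.sin (θ φ))) (Ici φ) φ := fun φ hφ => by
    have d := hθ.hasDerivWithinAt_Ici hφ
    refine (((h.1 φ).hasDerivWithinAt.mul d.cos).sub
      ((h.2 φ).hasDerivWithinAt.mul d.sin)).congr_deriv ?_
    have hs := (speed_pos δ φ).ne'
    have hsc := Real.sin_sq_add_cos_sq (θ φ)
    simp only [hk, phaseField]
    field_simp
    linear_combination (-(δ ^ 2 * Real.cos φ ^ 2 * u φ * Real.sin (θ φ))) * hsc
  have hcont : ContinuousOn (fun φ => u φ * Real.cos (θ φ) - v φ * Real.sin (θ φ))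
      (Icc 0 Real.pi) := by
    have hu : Continuous u := continuous_iff_continuousAt.2 fun φ => (h.1 φ).continuousAt
    have hv : Continuous v := continuous_iff_continuousAt.2 fun φ => (h.2 φ).continuousAt
    have := hθ.continuousOn
    fun_prop
  have hkb : ∀ φ, |k φ| ≤ δ ^ 2 := fun φ => by
    rw [hk]
    simp only [abs_mul, abs_div, abs_of_pos (speed_pos δ φ), abs_of_nonneg (sq_nonneg δ),
      abs_of_nonneg (sq_nonneg (Real.cos φ))]
    have h1 : δ ^ 2 * Real.cos φ ^ 2 / speed δ φ ≤ δ ^ 2 :=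
      (div_le_self (by positivity) (one_le_speed δ φ)).trans
        (mul_le_of_le_one_right (sq_nonneg _) (Real.cos_sq_le_one _))
    have h2 := Real.abs_sin_le_one (θ φ)
    have h3 := Real.abs_cos_le_one (θ φ)
    have := speed_pos δ φ
    calc _ ≤ δ ^ 2 * 1 * 1 := by gcongr
      _ = _ := by ring
  have g := norm_le_gronwallBound_of_norm_deriv_right_le (δ := 0) (K := δ ^ 2) (ε := 0) hcont hd
    (by simp [h0]) (fun φ _ => by
      rw [norm_mul, add_zero]
      exact mul_le_mul_of_nonneg_right (hkb φ) (norm_nonneg _)) Real.pi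
    (right_mem_Icc.2 Real.pi_pos.le)
  rw [gronwallBound_ε0_δ0] at g
  exact norm_le_zero_iff.1 g

/-- A solution with parallel nonzero values at `0` and `π` gives a rotation number. -/
theorem exists_hasRotation (h : IsAmpSolution δ ω u v) (hω : 0 ≤ ω)
    (h0 : ¬(u 0 = 0 ∧ v 0 = 0)) (hpar : u 0 * v Real.pi - v 0 * u Real.pi = 0) :
    ∃ n, HasRotation (δ, ω) n := by
  have hpi : ¬(u Real.pi = 0 ∧ v Real.pi = 0) := fun hz =>
    h0 (h.eq_zero_of_apply_eq_zero hω hz.1 hz.2 0)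
  set z : ℂ := ⟨v 0, u 0⟩ with hz
  obtain ⟨θ, hθ, hθ0⟩ := exists_isPhase hω δ z.arg
  have e1 : v 0 = ‖z‖ * Real.cos (θ 0) := by rw [hθ0, Complex.norm_mul_cos_arg]
  have e2 : u 0 = ‖z‖ * Real.sin (θ 0) := by rw [hθ0, Complex.norm_mul_sin_arg]
  have hr : ‖z‖ ≠ 0 := fun hr => h0 ⟨by rw [e2, hr, zero_mul], by rw [e1, hr, zero_mul]⟩
  have hend := h.phase_parallel hθ (by rw [e1, e2]; ring)
  have hpar' : Real.sin (θ 0) * v Real.pi - Real.cos (θ 0) * u Real.pi = 0 := by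
    rw [e1, e2] at hpar
    exact (mul_eq_zero.1 (by linear_combination hpar :
      ‖z‖ * (Real.sin (θ 0) * v Real.pi - Real.cos (θ 0) * u Real.pi) = 0)).resolve_left hr
  have hsin : Real.sin (θ Real.pi - θ 0) = 0 := by
    rw [Real.sin_sub]
    by_contra hne
    refine hpi ⟨?_, ?_⟩
    · refine (mul_eq_zero.1 (?_ : (Real.sin (θ Real.pi) * Real.cos (θ 0) -
        Real.cos (θ Real.pi) * Real.sin (θ 0)) * u Real.pi = 0)).resolve_left hne
      linear_combination (-Real.sin (θ 0)) * hend - Real.sin (θ Real.pi) * hpar'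
    · refine (mul_eq_zero.1 (?_ : (Real.sin (θ Real.pi) * Real.cos (θ 0) -
        Real.cos (θ Real.pi) * Real.sin (θ 0)) * v Real.pi = 0)).resolve_left hne
      linear_combination (-Real.cos (θ 0)) * hend - Real.cos (θ Real.pi) * hpar'
  obtain ⟨n, hn⟩ := Real.sin_eq_zero_iff.1 hsin
  exact ⟨n, θ, hθ, hn.symm⟩

/-- Without a rotation number the monodromy is elliptic, so that solutions are bounded. -/
theorem bounded_or_exists_hasRotation (h : IsAmpSolution δ ω u v) (hω : 0 ≤ ω) :
    (∃ M, ∀ φ, |u φ| ≤ M) ∨ ∃ n, HasRotation (δ, ω) n := by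
  by_cases h0 : u 0 = 0 ∧ v 0 = 0
  · exact Or.inl ⟨0, fun φ => by simp [(h.eq_zero_of_apply_eq_zero hω h0.1 h0.2 φ).1]⟩
  have hS := h.shift
  have hSS := hS.shift
  set c := u 0 * v (0 + Real.pi) - v 0 * u (0 + Real.pi) with hc
  by_cases hc0 : c = 0
  · exact Or.inr (h.exists_hasRotation hω h0 (by simpa [hc] using hc0))
  set d := u 0 * v (0 + Real.pi + Real.pi) - v 0 * u (0 + Real.pi + Real.pi) with hd
  have w1 : ∀ φ, u φ * v (φ + Real.pi) - v φ * u (φ + Real.pi) = c := fun φ =>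
    h.wronskian_eq hS φ 0
  have w2 : ∀ φ, u φ * v (φ + Real.pi + Real.pi) - v φ * u (φ + Real.pi + Real.pi) = d := fun φ =>
    h.wronskian_eq hSS φ 0
  obtain ⟨τ, hτ⟩ : ∃ τ, d = τ * c := ⟨d / c, (div_mul_cancel₀ d hc0).symm⟩
  -- The Cayley-Hamilton relation; `τ` is the trace of the monodromy.
  have ru : ∀ φ, u (φ + Real.pi + Real.pi) = τ * u (φ + Real.pi) - u φ := fun φ => by
    refine mul_left_cancel₀ hc0 ?_
    have e3 := w1 (φ + Real.pi)
    linear_combination (-u (φ + Real.pi + Real.pi)) * w1 φ + u (φ + Real.pi) * w2 φ -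
      u φ * e3 + u (φ + Real.pi) * hτ
  have rv : ∀ φ, v (φ + Real.pi + Real.pi) = τ * v (φ + Real.pi) - v φ := fun φ => by
    refine mul_left_cancel₀ hc0 ?_
    have e3 := w1 (φ + Real.pi)
    linear_combination (-v (φ + Real.pi + Real.pi)) * w1 φ + v (φ + Real.pi) * w2 φ -
      v φ * e3 + v (φ + Real.pi) * hτ
  by_cases hell : τ ^ 2 < 4
  · -- A positive definite quadratic form in `u φ`, `u (φ + π)` is periodic.
    left
    have hu : Continuous u := continuous_iff_continuousAt.2 fun φ => (h.1 φ).continuousAt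
    have hper : Function.Periodic
        (fun φ => u (φ + Real.pi) ^ 2 - τ * u φ * u (φ + Real.pi) + u φ ^ 2) Real.pi := fun φ => by
      simp only [ru]; ring
    obtain ⟨M, hM⟩ := (hper.isBounded_of_continuous Real.pi_ne_zero (by fun_prop)).exists_norm_le
    have hq : 0 < 1 - τ ^ 2 / 4 := by linarith
    refine ⟨M / (1 - τ ^ 2 / 4) + 1, fun φ => ?_⟩
    have h1 := (le_abs_self _).trans (hM _ (mem_range_self φ))
    have h2 : u φ ^ 2 ≤ M / (1 - τ ^ 2 / 4) := by
      rw [le_div_iff₀ hq]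
      nlinarith [sq_nonneg (u (φ + Real.pi) - τ / 2 * u φ)]
    nlinarith [sq_abs (u φ), sq_nonneg (|u φ| - 1)]
  · -- A real Floquet multiplier `μ`, and the Floquet solution with multiplier `μ⁻¹ = τ - μ`.
    right
    obtain ⟨μ, hμ⟩ : ∃ μ : ℝ, μ ^ 2 - τ * μ + 1 = 0 := by
      refine ⟨(τ + Real.sqrt (τ ^ 2 - 4)) / 2, ?_⟩
      have := Real.sq_sqrt (show 0 ≤ τ ^ 2 - 4 by linarith)
      linear_combination this / 4
    refine (hS.sub_const_mul h μ).exists_hasRotation hω (fun hz => hc0 ?_) ?_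
    · rw [hc]
      linear_combination u 0 * hz.2 - v 0 * hz.1
    · have a := ru 0
      have b := rv 0
      rw [zero_add] at a b ⊢
      rw [a, b]
      linear_combination (v Real.pi * u 0 - u Real.pi * v 0) * hμ

end IsAmpSolution

theorem exists_hasRotation_of_mem_unstableSet {x : ℝ × ℝ} (hx : x ∈ unstableSet) :
    ∃ n, HasRotation x n := by
  obtain ⟨-, hω, hun⟩ := hx
  by_contra hno
  refine hun fun ξ hξ => ?_
  obtain ⟨v, hv⟩ := hξ.exists_isAmpSolution hω
  obtain ⟨M, hM⟩ := (hv.bounded_or_exists_hasRotation hω.le).resolve_right hno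
  refine ⟨M, fun t => ?_⟩
  obtain ⟨φ, rfl⟩ := timeOfAmplitude_surjective hω x.1 t
  exact hM φ

/-! ### Averaging of the phase equation -/

theorem phaseField_zero (ω φ θ : ℝ) : phaseField 0 ω φ θ = ω := by
  simp [phaseField, speed]

theorem abs_phaseField_sub_le_of_nonneg {ω : ℝ} (hω : 0 ≤ ω) (δ φ θ : ℝ) :
    |phaseField δ ω φ θ - ω| ≤ (1 + ω) * δ ^ 2 := by
  simpa [phaseField_zero] using abs_phaseField_sub_params_le δ ω 0 φ θ hω

/-- If the slope of a phase is uniformly close to `a'`, then its increments are close to those of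
the antiderivative `a`. -/
theorem IsPhase.abs_sub_le_of_slope {δ ω : ℝ} {θ : ℝ → ℝ} (hθ : IsPhase δ ω θ) {a a' : ℝ → ℝ}
    {c : ℝ} (ha : ∀ φ, HasDerivAt a (a' φ) φ)
    (hc : ∀ φ ∈ Icc 0 Real.pi, |phaseField δ ω φ (θ φ) - a' φ| ≤ c) {φ : ℝ}
    (hφ : φ ∈ Icc 0 Real.pi) : |(θ φ - θ 0) - (a φ - a 0)| ≤ c * φ := by
  have h := Convex.norm_image_sub_le_of_norm_hasDerivWithin_le (f := fun φ => θ φ - a φ)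
    (fun x hx => (hθ x hx).sub (ha x).hasDerivWithinAt) (fun x hx => hc x hx)
    (convex_Icc 0 Real.pi) (left_mem_Icc.2 Real.pi_pos.le) hφ
  simp only [Real.norm_eq_abs, sub_zero, abs_of_nonneg hφ.1] at h
  refine le_trans (le_of_eq ?_) h
  congr 1
  ring

theorem HasRotation.abs_sub_le {δ ω : ℝ} (hω : 0 ≤ ω) {n : ℤ} (h : HasRotation (δ, ω) n) :
    |(n : ℝ) - ω| ≤ (1 + ω) * δ ^ 2 := by
  obtain ⟨θ, hθ, hn⟩ := h
  have hpi := Real.pi_pos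
  have h1 := IsPhase.abs_sub_le_of_slope hθ (a := fun φ => ω * φ) (a' := fun _ => ω)
    (fun φ => by simpa using (hasDerivAt_id φ).const_mul ω)
    (fun φ _ => abs_phaseField_sub_le_of_nonneg hω δ φ (θ φ)) (right_mem_Icc.2 hpi.le)
  simp only [hn, mul_zero, sub_zero] at h1
  rw [← sub_mul, abs_mul, abs_of_pos hpi] at h1
  exact le_of_mul_le_mul_right h1 hpi

theorem abs_one_div_speed_sub_taylor_le (δ φ : ℝ) :
    |1 / speed δ φ - (1 - δ ^ 2 / 2 + δ ^ 2 / 4 * Real.sin φ ^ 2)| ≤ δ ^ 4 := by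
  have hg := one_le_speed δ φ
  have hsq := sq_speed δ φ
  set g := speed δ φ
  have h0 := sq_nonneg (Real.sin φ)
  have h1 := Real.sin_sq_le_one φ
  have hd := sq_nonneg δ
  have hx0 : 0 ≤ g ^ 2 - 1 := by nlinarith
  have hx1 : g ^ 2 - 1 ≤ δ ^ 2 := by nlinarith
  have e : 1 / g - (1 - δ ^ 2 / 2 + δ ^ 2 / 4 * Real.sin φ ^ 2) =
      (g - 1) ^ 2 * ((g + 2) / (2 * g)) := by
    have : 1 - δ ^ 2 / 2 + δ ^ 2 / 4 * Real.sin φ ^ 2 = 1 - (g ^ 2 - 1) / 2 := by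
      rw [hsq]; ring
    rw [this]
    field_simp
    ring
  have h2 : (g + 2) / (2 * g) ≤ 2 := by
    rw [div_le_iff₀ (by positivity)]; linarith
  rw [e, abs_of_nonneg (by positivity)]
  calc (g - 1) ^ 2 * ((g + 2) / (2 * g)) ≤ (g - 1) ^ 2 * (g + 1) ^ 2 := by
        gcongr
        nlinarith
    _ = (g ^ 2 - 1) ^ 2 := by ring
    _ ≤ (δ ^ 2) ^ 2 := by gcongr
    _ = δ ^ 4 := by ring

theorem cos_sq_mul_sin_sq_eq (a l φ : ℝ) :
    Real.cos φ ^ 2 * Real.sin (a + l * φ) ^ 2 =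
      (1 + Real.cos (2 * φ) - Real.cos (2 * a + 2 * l * φ) -
        (Real.cos (2 * a + 2 * (l + 1) * φ) + Real.cos (2 * a + 2 * (l - 1) * φ)) / 2) / 4 := by
  have e1 : Real.cos (2 * a + 2 * (l + 1) * φ) + Real.cos (2 * a + 2 * (l - 1) * φ) =
      2 * (Real.cos (2 * (a + l * φ)) * Real.cos (2 * φ)) := by
    rw [show 2 * a + 2 * (l + 1) * φ = 2 * (a + l * φ) + 2 * φ by ring,
      show 2 * a + 2 * (l - 1) * φ = 2 * (a + l * φ) - 2 * φ by ring, Real.cos_add, Real.cos_sub]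
    ring
  rw [e1, show 2 * a + 2 * l * φ = 2 * (a + l * φ) by ring, Real.cos_two_mul φ,
    Real.cos_two_mul (a + l * φ), Real.sin_sq]
  ring

/-- An antiderivative of the expansion of the phase field up to `O(δ ^ 4)`, taken along the
approximate phase `a + l φ`. -/
noncomputable def averagedPhase (δ ω a l φ : ℝ) : ℝ :=
  ω * (φ - δ ^ 2 / 2 * φ + δ ^ 2 / 8 * (φ - Real.sin (2 * φ) / 2)) +
    δ ^ 2 / 4 * (φ + Real.sin (2 * φ) / 2 - Real.sin (2 * a + 2 * l * φ) / (2 * l) -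
      (Real.sin (2 * a + 2 * (l + 1) * φ) / (2 * (l + 1)) +
        Real.sin (2 * a + 2 * (l - 1) * φ) / (2 * (l - 1))) / 2)

theorem hasDerivAt_averagedPhase (δ ω a : ℝ) {l : ℝ} (hl : 1 < l) (φ : ℝ) :
    HasDerivAt (averagedPhase δ ω a l)
      (ω * (1 - δ ^ 2 / 2 + δ ^ 2 / 4 * Real.sin φ ^ 2) +
        δ ^ 2 * (Real.cos φ ^ 2 * Real.sin (a + l * φ) ^ 2)) φ := by
  have hs : ∀ b c : ℝ, c ≠ 0 → HasDerivAt (fun φ => Real.sin (b + c * φ) / c)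
      (Real.cos (b + c * φ)) φ := fun b c hc => by
    have := ((((hasDerivAt_id φ).const_mul c).const_add b).sin).div_const c
    refine this.congr_deriv ?_
    simp only [id]
    field_simp
  have h2 : HasDerivAt (fun φ => Real.sin (2 * φ) / 2) (Real.cos (2 * φ)) φ := by
    simpa using hs 0 2 two_ne_zero
  have hi := hasDerivAt_id' φ
  have d := (((hi.sub (hi.const_mul (δ ^ 2 / 2))).add
    ((hi.sub h2).const_mul (δ ^ 2 / 8))).const_mul ω).add
    ((((hi.add h2).sub (hs (2 * a) (2 * l) (by linarith))).sub
      (((hs (2 * a) (2 * (l + 1)) (by linarith)).add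
        (hs (2 * a) (2 * (l - 1)) (by linarith))).div_const 2)).const_mul (δ ^ 2 / 4))
  refine d.congr_deriv ?_
  rw [cos_sq_mul_sin_sq_eq, Real.sin_sq_eq_half_sub]
  ring

/-- Only the mean survives over a period, since `l` and `l ± 1` are nonzero integers. -/
theorem averagedPhase_pi_sub_zero (δ ω a : ℝ) (l : ℕ) :
    averagedPhase δ ω a l Real.pi - averagedPhase δ ω a l 0 =
      (ω * (1 - 3 * δ ^ 2 / 8) + δ ^ 2 / 4) * Real.pi := by
  have hs : ∀ k : ℤ, Real.sin (2 * a + 2 * (k : ℝ) * Real.pi) = Real.sin (2 * a) := fun k => by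
    rw [show 2 * a + 2 * (k : ℝ) * Real.pi = 2 * a + k * (2 * Real.pi) by ring,
      Real.sin_add_int_mul_two_pi]
  have h1 := hs l
  have h2 := hs (l + 1)
  have h3 := hs (l - 1)
  push_cast at h1 h2 h3
  simp only [averagedPhase, h1, h2, h3, Real.sin_two_pi, mul_zero, add_zero, Real.sin_zero]
  ring

theorem abs_phaseField_sub_averaged_le {ω : ℝ} (hω : 0 ≤ ω) (δ φ θ ψ : ℝ) :
    |phaseField δ ω φ θ - (ω * (1 - δ ^ 2 / 2 + δ ^ 2 / 4 * Real.sin φ ^ 2) +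
      δ ^ 2 * (Real.cos φ ^ 2 * Real.sin ψ ^ 2))| ≤ (ω + 1) * δ ^ 4 + δ ^ 2 * |θ - ψ| := by
  obtain ⟨hX0, hX1⟩ := trig_weight_bounds φ θ
  have e : phaseField δ ω φ θ - (ω * (1 - δ ^ 2 / 2 + δ ^ 2 / 4 * Real.sin φ ^ 2) +
      δ ^ 2 * (Real.cos φ ^ 2 * Real.sin ψ ^ 2)) =
      ω * (1 / speed δ φ - (1 - δ ^ 2 / 2 + δ ^ 2 / 4 * Real.sin φ ^ 2)) +
        δ ^ 2 * (Real.cos φ ^ 2 * Real.sin θ ^ 2 * (1 / speed δ φ - 1)) +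
        δ ^ 2 * (Real.cos φ ^ 2 * (Real.sin θ ^ 2 - Real.sin ψ ^ 2)) := by
    simp only [phaseField]; ring
  have b1 := abs_one_div_speed_sub_taylor_le δ φ
  have b2 : |1 / speed δ φ - 1| ≤ δ ^ 2 := by
    simpa [speed] using abs_one_div_speed_sub_le δ 0 φ
  have b3 := abs_sin_sq_sub_sin_sq_le θ ψ
  rw [e]
  refine (abs_add_three _ _ _).trans ?_
  rw [abs_mul ω, abs_of_nonneg hω, abs_mul (δ ^ 2), abs_mul (δ ^ 2), abs_of_nonneg (sq_nonneg δ),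
    abs_mul, abs_of_nonneg hX0, abs_mul (Real.cos φ ^ 2), abs_of_nonneg (sq_nonneg (Real.cos φ))]
  have c2 := mul_le_mul hX1 b2 (abs_nonneg _) zero_le_one
  have c3 := mul_le_mul (Real.cos_sq_le_one φ) b3 (abs_nonneg _) zero_le_one
  rw [one_mul] at c2 c3
  calc _ ≤ ω * δ ^ 4 + δ ^ 2 * δ ^ 2 + δ ^ 2 * |θ - ψ| := by gcongr
    _ = _ := by ring

/-- The parameters with rotation number `l ≥ 2` form a thin tongue of width `O(δ ^ 4)`. -/
theorem HasRotation.abs_sub_le_of_two_le {l : ℕ} (hl : 2 ≤ l) {δ ω : ℝ} (hω : 0 ≤ ω)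
    (hδ : δ ^ 2 ≤ 1 / 2) (h : HasRotation (δ, ω) l) :
    |ω - (l + (3 * (l : ℝ) / 8 - 1 / 4) * δ ^ 2)| ≤ 19 * (l + 1) * δ ^ 4 := by
  have hl' : (2 : ℝ) ≤ l := by exact_mod_cast hl
  have hpi := Real.pi_pos
  have hd := sq_nonneg δ
  have r1 := h.abs_sub_le hω
  rw [Int.cast_natCast] at r1
  have hω2 : ω ≤ 2 * l + 1 := by nlinarith [(abs_le.1 r1).1]
  have r2 : |(l : ℝ) - ω| ≤ (2 * l + 2) * δ ^ 2 := by
    refine r1.trans (mul_le_mul_of_nonneg_right ?_ hd)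
    linarith
  obtain ⟨θ, hθ, hn⟩ := h
  rw [Int.cast_natCast] at hn
  -- The phase is `O(δ ^ 2)`-close to `θ 0 + l φ`.
  have s1 : ∀ φ ∈ Icc 0 Real.pi, |θ φ - (θ 0 + l * φ)| ≤ 16 * (l + 1) * δ ^ 2 := fun φ hφ => by
    have t := IsPhase.abs_sub_le_of_slope hθ (a := fun φ => l * φ) (a' := fun _ => (l : ℝ))
      (c := 4 * (l + 1) * δ ^ 2)
      (fun φ => by simpa using (hasDerivAt_id φ).const_mul (l : ℝ)) (fun x _ => ?_) hφ
    · have hφ4 : φ ≤ 4 := hφ.2.trans Real.pi_le_four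
      simp only [mul_zero, sub_zero] at t
      rw [show θ φ - (θ 0 + l * φ) = θ φ - θ 0 - l * φ by ring]
      refine t.trans ?_
      calc 4 * ((l : ℝ) + 1) * δ ^ 2 * φ ≤ 4 * ((l : ℝ) + 1) * δ ^ 2 * 4 := by gcongr
        _ = _ := by ring
    · have u1 := abs_phaseField_sub_le_of_nonneg hω δ x (θ x)
      have u2 : |phaseField δ ω x (θ x) - l| ≤ |phaseField δ ω x (θ x) - ω| + |(l : ℝ) - ω| := by
        rw [abs_sub_comm (l : ℝ)]
        exact _root_.abs_sub_le _ _ _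
      have u3 : (1 + ω) * δ ^ 2 ≤ (2 * l + 2) * δ ^ 2 :=
        mul_le_mul_of_nonneg_right (by linarith) hd
      linarith
  have s2 := IsPhase.abs_sub_le_of_slope hθ (c := 18 * (l + 1) * δ ^ 4)
    (fun φ => hasDerivAt_averagedPhase δ ω (θ 0) (by linarith : (1 : ℝ) < l) φ) (fun φ hφ => by
      refine (abs_phaseField_sub_averaged_le hω δ φ (θ φ) (θ 0 + l * φ)).trans ?_
      calc _ ≤ (2 * l + 1 + 1) * δ ^ 4 + δ ^ 2 * (16 * (l + 1) * δ ^ 2) := by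
            gcongr
            exact s1 φ hφ
        _ = _ := by ring) (right_mem_Icc.2 hpi.le)
  rw [hn, averagedPhase_pi_sub_zero, ← sub_mul, abs_mul, abs_of_pos hpi] at s2
  have s3 := le_of_mul_le_mul_right s2 hpi
  have e : ω - (l + (3 * (l : ℝ) / 8 - 1 / 4) * δ ^ 2) =
      -(l - (ω * (1 - 3 * δ ^ 2 / 8) + δ ^ 2 / 4)) + -(3 / 8 * δ ^ 2) * (l - ω) := by ring
  rw [e]
  refine (abs_add_le _ _).trans ?_
  rw [abs_neg, abs_mul, abs_neg, abs_of_nonneg (by positivity : 0 ≤ 3 / 8 * δ ^ 2)]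
  have s4 : 3 / 8 * δ ^ 2 * |(l : ℝ) - ω| ≤ 3 / 8 * δ ^ 2 * ((2 * l + 2) * δ ^ 2) := by gcongr
  have s5 : 0 ≤ (l + 1) * δ ^ 4 := by positivity
  nlinarith

/-! ### The resonance tongues -/

theorem hasRotation_of_mem_tongue {l : ℕ} {x : ℝ × ℝ} (hx : x ∈ tongue l) : HasRotation x l := by
  obtain ⟨hxi, hcl⟩ := hx
  have hsub : connectedComponentIn (interior unstableSet) x ⊆ unstableSet :=
    (connectedComponentIn_subset _ _).trans interior_subset
  have hnhds : {y : ℝ × ℝ | |y.2 - l| + (1 + y.2) * y.1 ^ 2 < 1} ∈ 𝓝 ((0 : ℝ), (l : ℝ)) := by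
    refine (isOpen_lt (by fun_prop) continuous_const).mem_nhds ?_
    simp
  obtain ⟨y, hyn, hyS⟩ := mem_closure_iff_nhds.1 hcl _ hnhds
  obtain ⟨n, hn⟩ := exists_hasRotation_of_mem_unstableSet (hsub hyS)
  have hnl : n = l := by
    have h1 := HasRotation.abs_sub_le (hsub hyS).2.1.le hn
    have h2 : |((n - l : ℤ) : ℝ)| < 1 := by
      push_cast
      have h3 : |(n : ℝ) - l| ≤ |(n : ℝ) - y.2| + |y.2 - l| := abs_sub_le _ _ _
      simp only [mem_ofPred_eq] at hyn
      linarith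
    rw [← Int.cast_abs] at h2
    exact sub_eq_zero.1 (Int.abs_lt_one_iff.1 (by exact_mod_cast h2))
  rw [← hnl]
  exact HasRotation.of_isPreconnected isPreconnected_connectedComponentIn
    (fun z hz => (hsub hz).2.1.le)
    (fun z hz => exists_hasRotation_of_mem_unstableSet (hsub hz)) hyS
    (mem_connectedComponentIn hxi) hn

end DuffingHill

theorem corollary4p4 (l : ℕ) (hl : 2 ≤ l) :
    ∃ C δ₀ : ℝ, 0 < δ₀ ∧ ∀ δ ω : ℝ, (δ, ω) ∈ DuffingHill.tongue l → δ < δ₀ →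
      (l : ℝ) + (3 * (l : ℝ) / 8 - 1 / 4 - 1 / (2 * Real.pi * (l : ℝ))) * δ ^ 2 - C * δ ^ 4 ≤ ω ∧
      ω ≤ (l : ℝ) + (3 * (l : ℝ) / 8 - 1 / 4 + 1 / (2 * Real.pi * (l : ℝ))) * δ ^ 2
        + C * δ ^ 4 := by
  refine ⟨19 * (l + 1), 1 / 2, by norm_num, fun δ ω hmem hδ => ?_⟩
  obtain ⟨hδ0, hω, -⟩ := interior_subset hmem.1
  simp only at hδ0 hω
  have h := DuffingHill.HasRotation.abs_sub_le_of_two_le hl hω.le (by nlinarith)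
    (DuffingHill.hasRotation_of_mem_tongue hmem)
  have hw : 0 ≤ 1 / (2 * Real.pi * (l : ℝ)) * δ ^ 2 := by have := Real.pi_pos; positivity
  obtain ⟨h1, h2⟩ := abs_le.1 h
  constructor <;> linarith
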